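/- \textbf{Setting.} Let $\mu$ be a $\sigma$-finite measure on a measurable space $Z$, $\Theta\subseteq\mathbb R^l$, $\mathcal S\subseteq\mathbb R^q$, $S:Z\to\mathcal S$ measurable, $\psi:\Theta\to\mathbb R$, $\phi:\Theta\to\mathbb R^q$, and put $$L(s;\theta)=\psi(\theta)+\langle s,\phi(\theta)\rangle,\quad h(z;\theta)=e^{L(S(z);\theta)},\quad f(\theta)=\int h(z;\theta)\,\mu(dz),\quad p_\theta(z)=\frac{h(z;\theta)}{f(\theta)},\quad \bar S(\theta)=\int S\,p_\theta\,d\mu .$$ (\textbf{M1}) is this setting. (\textbf{M2}) (a) $\psi,\phi$ are continuous on $\Theta$; (b) for all $\theta\in\Theta$ the integral $\bar S(\theta)$ converges absolutely, $\bar S(\theta)\in\mathcal S$, and $\bar S$ is continuous on $\Theta$; (c) $\hat\theta:\mathcal S\to\Theta$ is a continuous function with $L(s;\hat\theta(s))=\sup_{\theta\in\Theta}L(s;\theta)$ for all $s\in\mathcal S$; (d) $f$ is positive, finite and continuous on $\Theta$, and $\{\theta\in\Theta: f(\theta)\ge c\}$ is compact for every $c>0$. Let $T=\hat\theta\circ\bar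 S$ be the EM map. Let $\mathcal L$ be either the set $\{\theta\in\Theta:T(\theta)=\theta\}$ of stationary points of EM or, if $\Theta$ is open and $\psi,\phi,f$ are differentiable on $\Theta$, the set $\{\theta\in\Theta:\nabla f(\theta)=0\}$ of critical points of $f$ (the theorem holds for each of the two choices). (\textbf{M3}) Either $f(\mathcal L)$ is compact, or $f(\mathcal L\cap K)$ is finite for every compact $K\subseteq\Theta$. \textbf{Algorithm.} For $n\in\mathbb N$ and $\theta\in\Theta$ let $\tilde p_{\theta,n}:Z\to\mathbb R$ be a (deterministic) measurable function such that $\tilde S_n(\theta)=\int S\,\tilde p_{\theta,n}\,d\mu$ converges absolutely and lies in $\mathcal S$, and put $F_n(\theta)=\hat\theta(\tilde S_n(\theta))$. Let $(K_n)_{n\ge0}$ be an increasing sequence of compact sets with $\bigcup_nK_n=\Theta$ such that every compact subset of $\Theta$ is contained in some $K_n$, and let $\theta_0\in K_0$. The stable approximate EM sequence starts from $\theta_0$ and $p_0=0$; if $F_n(\theta_n)\in K_{p_n}$, then $\theta_{n+1}=F_n(\theta_n)$ and $p_{n+1}=p_n$; otherwise it is reinitialised, $\theta_{n+1}=\theta_0$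 and $p_{n+1}=p_n+1$. \textbf{Theorem.} Assume M1--M3, and that for every $u\in\{1,\dots,q\}$ and every compact $K\subseteq\Theta$ one of the following holds: $$\int S_u^2\,d\mu<\infty\quad\text{and}\quad\sup_{\theta\in K}\int(\tilde p_{\theta,n}-p_\theta)^2\,d\mu\xrightarrow[n\to\infty]{}0,$$ $$\text{or}\quad\sup_{\theta\in K}\int S_u^2\,p_\theta\,d\mu<\infty\quad\text{and}\quad\sup_{\theta\in K}\int\Big(\frac{\tilde p_{\theta,n}}{p_\theta}-1\Big)^2p_\theta\,d\mu\xrightarrow[n\to\infty]{}0.$$ Then, with $\mathrm{Cl}$ the closure of $\{\theta_n:n\in\mathbb N\}$: (i)(a) $(p_n)$ is bounded and $(\theta_n)$ stays in a compact subset of $\Theta$; (i)(b) there is a connected component $C$ of $f(\mathcal L\cap\mathrm{Cl})$ with $\mathrm{dist}(f(\theta_n),C)\to0$; in particular $f(\mathcal L\cap\mathrm{Cl})$ is non-empty; (ii) if $f(\mathcal L\cap\mathrm{Cl})$ has empty interior, then there is $f^*\in\mathbb R$ with $f(\theta_n)\to f^*$, and with $\mathcal L_{f^*}=\{\theta\in\mathcal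 L:f(\theta)=f^*\}$ the set $\mathcal L_{f^*}\cap\mathrm{Cl}$ is non-empty and $\mathrm{dist}(\theta_n,\mathcal L_{f^*}\cap\mathrm{Cl})\to0$. -/

import Mathlib

open Filter Topology MeasureTheory Set
open scoped ENNReal

/-- A curved exponential family, seen from the fixed observation: parameter set `Θ ⊆ ℝˡ`, set of
statistics `𝒮 ⊆ ℝ^q`, a sufficient statistic `S` of the hidden variable with values in `𝒮`, and the
functions `ψ : Θ → ℝ` and `φ : Θ → ℝ^q` (only their restrictions to `Θ` matter). -/
structure CurvedExpFamily (Z : Type*) [MeasurableSpace Z] (l q : ℕ) where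
  /-- the parameter set -/
  Θ : Set (EuclideanSpace ℝ (Fin l))
  /-- the set of statistics -/
  𝒮 : Set (EuclideanSpace ℝ (Fin q))
  /-- the scalar part of the log-density -/
  ψ : EuclideanSpace ℝ (Fin l) → ℝ
  /-- the natural parameter -/
  φ : EuclideanSpace ℝ (Fin l) → EuclideanSpace ℝ (Fin q)
  /-- the sufficient statistic -/
  S : Z → EuclideanSpace ℝ (Fin q)
  measurable_S : Measurable S
  S_mem : ∀ z, S z ∈ 𝒮

namespace CurvedExpFamily

variable {Z : Type*} [MeasurableSpace Z] {l q : ℕ}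

/-- `L(s; θ) = ψ(θ) + ⟨s, φ(θ)⟩`. -/
noncomputable def L (M : CurvedExpFamily Z l q) (s : EuclideanSpace ℝ (Fin q))
    (θ : EuclideanSpace ℝ (Fin l)) : ℝ :=
  M.ψ θ + inner ℝ s (M.φ θ)

/-- The complete likelihood `h(z; θ) = exp L(S(z); θ)`. -/
noncomputable def h (M : CurvedExpFamily Z l q) (θ : EuclideanSpace ℝ (Fin l)) (z : Z) : ℝ :=
  Real.exp (M.L (M.S z) θ)

/-- The (observed) likelihood `f(θ) = ∫ h(z; θ) μ(dz)`. -/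
noncomputable def f (M : CurvedExpFamily Z l q) (μ : Measure Z)
    (θ : EuclideanSpace ℝ (Fin l)) : ℝ :=
  ∫ z, M.h θ z ∂μ

/-- The conditional density of the hidden variable `p_θ(z) = h(z; θ) / f(θ)`. -/
noncomputable def p (M : CurvedExpFamily Z l q) (μ : Measure Z)
    (θ : EuclideanSpace ℝ (Fin l)) (z : Z) : ℝ :=
  M.h θ z / M.f μ θ

/-- The exact E-step `S̄(θ) = ∫ S(z) p_θ(z) μ(dz)`. -/
noncomputable def Sbar (M : CurvedExpFamily Z l q) (μ : Measure Z)
    (θ : EuclideanSpace ℝ (Fin l)) : EuclideanSpace ℝ (Fin q) :=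
  ∫ z, M.p μ θ z • M.S z ∂μ

/-- An E-step `∫ S(z) r(z) μ(dz)` made with a function `r` in place of the conditional density. -/
noncomputable def Stilde (M : CurvedExpFamily Z l q) (μ : Measure Z) (r : Z → ℝ) :
    EuclideanSpace ℝ (Fin q) :=
  ∫ z, r z • M.S z ∂μ

/-- Regularity of the model; `θhat` is the M-step. -/
structure M2 (M : CurvedExpFamily Z l q) (μ : Measure Z)
    (θhat : EuclideanSpace ℝ (Fin q) → EuclideanSpace ℝ (Fin l)) : Prop where
  continuousOn_ψ : ContinuousOn M.ψ M.Θ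
  continuousOn_φ : ContinuousOn M.φ M.Θ
  integrable_S : ∀ θ ∈ M.Θ, Integrable (fun z => M.p μ θ z • M.S z) μ
  Sbar_mem : ∀ θ ∈ M.Θ, M.Sbar μ θ ∈ M.𝒮
  continuousOn_Sbar : ContinuousOn (M.Sbar μ) M.Θ
  continuousOn_θhat : ContinuousOn θhat M.𝒮
  θhat_mem : ∀ s ∈ M.𝒮, θhat s ∈ M.Θ
  θhat_max : ∀ s ∈ M.𝒮, ∀ θ ∈ M.Θ, M.L s θ ≤ M.L s (θhat s)
  f_finite : ∀ θ ∈ M.Θ, Integrable (M.h θ) μ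
  f_pos : ∀ θ ∈ M.Θ, 0 < M.f μ θ
  continuousOn_f : ContinuousOn (M.f μ) M.Θ
  isCompact_level : ∀ c : ℝ, 0 < c → IsCompact {θ ∈ M.Θ | c ≤ M.f μ θ}

/-- The exact EM map `T = θ̂ ∘ S̄`. -/
noncomputable def T (M : CurvedExpFamily Z l q) (μ : Measure Z)
    (θhat : EuclideanSpace ℝ (Fin q) → EuclideanSpace ℝ (Fin l))
    (θ : EuclideanSpace ℝ (Fin l)) : EuclideanSpace ℝ (Fin l) :=
  θhat (M.Sbar μ θ)

/-- The stationary points of the exact EM. -/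
def stationarySet (M : CurvedExpFamily Z l q) (μ : Measure Z)
    (θhat : EuclideanSpace ℝ (Fin q) → EuclideanSpace ℝ (Fin l)) :
    Set (EuclideanSpace ℝ (Fin l)) :=
  {θ ∈ M.Θ | M.T μ θhat θ = θ}

/-- The critical points of the likelihood, `∇f(θ) = 0`. -/
def criticalSet (M : CurvedExpFamily Z l q) (μ : Measure Z) :
    Set (EuclideanSpace ℝ (Fin l)) :=
  {θ ∈ M.Θ | HasGradientAt (M.f μ) 0 θ}

/-- The setting in which `∇f` makes sense: `Θ` is open and `ψ`, `φ`, `f` are differentiable. -/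
structure Smooth (M : CurvedExpFamily Z l q) (μ : Measure Z) : Prop where
  isOpen_Θ : IsOpen M.Θ
  differentiableOn_ψ : DifferentiableOn ℝ M.ψ M.Θ
  differentiableOn_φ : DifferentiableOn ℝ M.φ M.Θ
  differentiableOn_f : DifferentiableOn ℝ (M.f μ) M.Θ

/-- The condition on the likelihood values at the points of `ℒ`. -/
def M3 (M : CurvedExpFamily Z l q) (μ : Measure Z) (ℒ : Set (EuclideanSpace ℝ (Fin l))) : Prop :=
  IsCompact (M.f μ '' ℒ) ∨ ∀ K ⊆ M.Θ, IsCompact K → (M.f μ '' (ℒ ∩ K)).Finite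

/-- The approximations `ptilde n θ` of the densities `p_θ` give a well defined E-step in `𝒮`. -/
structure WellDefinedEStep (M : CurvedExpFamily Z l q) (μ : Measure Z)
    (ptilde : ℕ → EuclideanSpace ℝ (Fin l) → Z → ℝ) : Prop where
  measurable : ∀ n, ∀ θ ∈ M.Θ, Measurable (ptilde n θ)
  integrable : ∀ n, ∀ θ ∈ M.Θ, Integrable (fun z => ptilde n θ z • M.S z) μ
  mem : ∀ n, ∀ θ ∈ M.Θ, M.Stilde μ (ptilde n θ) ∈ M.𝒮

/-- First configuration: `∫ S_u² < ∞` and `sup_{θ ∈ K} ∫ (p̃_{θ,n} - p_θ)² → 0`. -/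
def ApproxL2 (M : CurvedExpFamily Z l q) (μ : Measure Z)
    (ptilde : ℕ → EuclideanSpace ℝ (Fin l) → Z → ℝ)
    (K : Set (EuclideanSpace ℝ (Fin l))) (u : Fin q) : Prop :=
  (∫⁻ z, ENNReal.ofReal (M.S z u ^ 2) ∂μ) < ∞ ∧
  Tendsto (fun n => ⨆ θ ∈ K, ∫⁻ z, ENNReal.ofReal ((ptilde n θ z - M.p μ θ z) ^ 2) ∂μ)
    atTop (𝓝 0)

/-- Second configuration: `sup_{θ ∈ K} ∫ S_u² p_θ < ∞` and
`sup_{θ ∈ K} ∫ (p̃_{θ,n} / p_θ - 1)² p_θ → 0`. -/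
def ApproxChiSq (M : CurvedExpFamily Z l q) (μ : Measure Z)
    (ptilde : ℕ → EuclideanSpace ℝ (Fin l) → Z → ℝ)
    (K : Set (EuclideanSpace ℝ (Fin l))) (u : Fin q) : Prop :=
  (⨆ θ ∈ K, ∫⁻ z, ENNReal.ofReal (M.S z u ^ 2 * M.p μ θ z) ∂μ) < ∞ ∧
  Tendsto (fun n => ⨆ θ ∈ K,
      ∫⁻ z, ENNReal.ofReal ((ptilde n θ z / M.p μ θ z - 1) ^ 2 * M.p μ θ z) ∂μ)
    atTop (𝓝 0)

/-- The approximate EM map `F_n(θ) = θ̂(S̃_n(θ))`, with `S̃_n(θ) = ∫ S(z) p̃_{θ,n}(z) μ(dz)`. -/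
noncomputable def approxMap (M : CurvedExpFamily Z l q) (μ : Measure Z)
    (θhat : EuclideanSpace ℝ (Fin q) → EuclideanSpace ℝ (Fin l))
    (ptilde : ℕ → EuclideanSpace ℝ (Fin l) → Z → ℝ)
    (n : ℕ) (θ : EuclideanSpace ℝ (Fin l)) : EuclideanSpace ℝ (Fin l) :=
  θhat (M.Stilde μ (ptilde n θ))

end CurvedExpFamily

open Classical in
/-- The stable (truncated) iteration of maps `F n` along the sets `K 0 ⊆ K 1 ⊆ ⋯`; the value at `n`
is the pair `(θ_n, p_n)`. If `F_n(θ_n) ∈ K_{p_n}` then `θ_{n+1} = F_n(θ_n)` and `p_{n+1} = p_n`;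
otherwise the iteration is reinitialised: `θ_{n+1} = θ_0` and `p_{n+1} = p_n + 1`. -/
noncomputable def stableIter {E : Type*} (F : ℕ → E → E) (K : ℕ → Set E) (θ₀ : E) : ℕ → E × ℕ
  | 0 => (θ₀, 0)
  | n + 1 =>
    let x := stableIter F K θ₀ n
    if F n x.1 ∈ K x.2 then (F n x.1, x.2) else (θ₀, x.2 + 1)

/-- An increasing sequence of compact subsets of `Θ` that covers `Θ` and swallows every compact
subset of `Θ`. -/
structure IsTruncationSeq {E : Type*} [TopologicalSpace E] (Θ : Set E) (K : ℕ → Set E) :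
    Prop where
  isCompact : ∀ n, IsCompact (K n)
  mono : Monotone K
  iUnion_eq : ⋃ n, K n = Θ
  absorbs : ∀ C ⊆ Θ, IsCompact C → ∃ n, C ⊆ K n

/-!
Jensen's inequality under the conditional law of the hidden variable, an exponential tilting of `μ`,
gives `f θ * exp (L(S̄ θ; θ') - L(S̄ θ; θ)) ≤ f θ'`. With `θ' = T θ` the likelihood is a Lyapunov
function of the EM map: it never decreases, and if it stays constant the two conditional laws agree,
so `T θ` is stationary. For fixed `θ` the left side is a smooth minorant of `f` touching it at `θ`,
so stationary points are critical points.

By Cauchy–Schwarz the approximate maps converge to `T` uniformly on compact sets. A superlevel set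
of `f` at a level outside `f(ℒ)` is therefore eventually invariant, which stops the
reinitialisations. After that the orbit follows `T` up to vanishing errors, so `f(θ_n)` can cross a
level downwards infinitely often only near a point of `ℒ` at that level. Hence the whole interval
between the lower and the upper limit of `f(θ_n)` lies in `f(ℒ ∩ Cl)`.
-/

section UniformConvergence

theorem tendstoUniformlyOn_comp_of_isCompact_image {ι α β γ : Type*} [UniformSpace β]
    [UniformSpace γ] {l : Filter ι} {G : ι → α → β} {G₀ : α → β} {C : Set α} {D : Set β}
    {g : β → γ} (hG : TendstoUniformlyOn G G₀ l C) (hG₀ : IsCompact (G₀ '' C))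
    (hG₀D : MapsTo G₀ C D) (hGD : ∀ i, MapsTo (G i) C D) (hg : ContinuousOn g D) :
    TendstoUniformlyOn (fun i => g ∘ G i) (g ∘ G₀) l C := by
  intro r hr
  have hcompact : IsCompact ((↑) ⁻¹' (G₀ '' C) : Set D) :=
    (IsInducing.subtypeVal.isCompact_preimage_iff (by simpa using hG₀D.image_subset)).2 hG₀
  have huniform := hcompact.uniformContinuousAt_of_continuousAt (D.domRestrict g)
    (fun a _ => (continuousOn_iff_continuous_domRestrict.1 hg).continuousAt) hr
  rw [uniformity_subtype, mem_comap] at huniform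
  obtain ⟨t, ht, hts⟩ := huniform
  filter_upwards [hG t ht] with i hi x hx
  exact hts (a := (⟨G₀ x, hG₀D hx⟩, ⟨G i x, hGD i hx⟩)) (hi x hx) (mem_image_of_mem G₀ hx)

theorem tendstoUniformlyOn_euclideanSpace {ι κ α : Type*} [Finite κ] {l : Filter ι}
    {G : ι → α → EuclideanSpace ℝ κ} {G₀ : α → EuclideanSpace ℝ κ} {C : Set α}
    (h : ∀ u, TendstoUniformlyOn (fun i x => G i x u) (fun x => G₀ x u) l C) :
    TendstoUniformlyOn G G₀ l C := by
  have := Fintype.ofFinite κ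
  have hpi : TendstoUniformlyOn (fun i x => (G i x).ofLp) (fun x => (G₀ x).ofLp) l C := by
    simp only [Metric.tendstoUniformlyOn_iff] at h ⊢
    intro ε hε
    filter_upwards [eventually_all.2 fun u => h u ε hε] with i hi x hx
    exact (dist_pi_lt_iff hε).2 fun u => hi u x hx
  exact (PiLp.uniformContinuous_toLp 2 fun _ : κ => ℝ).comp_tendstoUniformlyOn hpi

theorem tendstoUniformlyOn_of_edist_le {ι α β : Type*} [PseudoEMetricSpace β] {l : Filter ι}
    {G : ι → α → β} {G₀ : α → β} {C : Set α} {b : ι → ℝ≥0∞} (hb : Tendsto b l (𝓝 0))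
    (h : ∀ i, ∀ x ∈ C, edist (G i x) (G₀ x) ≤ b i) : TendstoUniformlyOn G G₀ l C := by
  refine EMetric.tendstoUniformlyOn_iff.2 fun ε hε => ?_
  filter_upwards [hb.eventually (gt_mem_nhds hε)] with i hi x hx
  exact (edist_comm _ _).trans_lt ((h i x hx).trans_lt hi)

end UniformConvergence

theorem tendsto_infDist_zero_of_tendsto {ι E : Type*} [PseudoMetricSpace E] {l : Filter ι}
    {u : ι → E} {x : E} {A : Set E} (hx : x ∈ A) (hu : Tendsto u l (𝓝 x)) :
    Tendsto (fun i => Metric.infDist (u i) A) l (𝓝 0) := by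
  simpa only [Metric.infDist_zero_of_mem hx, Function.comp_def]
    using ((Metric.continuous_infDist_pt A).tendsto x).comp hu

theorem frequently_le_and_succ_le {α : Type*} [LinearOrder α] {w : ℕ → α} {s t : α} (hst : s ≤ t)
    (hs : ∃ᶠ n in atTop, s < w n) (ht : ∃ᶠ n in atTop, w n < t) :
    ∃ᶠ n in atTop, s ≤ w n ∧ w (n + 1) ≤ t := by
  intro hnot
  obtain ⟨N, hN⟩ := eventually_atTop.1 hnot
  obtain ⟨n, hn, hsn⟩ := frequently_atTop.1 hs N
  have hstay : ∀ k ≥ n + 1, t < w k := by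
    refine Nat.le_induction (not_le.1 fun h => hN n hn ⟨hsn.le, h⟩) fun k hk htk => ?_
    exact not_le.1 fun h => hN k (by omega) ⟨hst.trans htk.le, h⟩
  obtain ⟨k, hk, hkt⟩ := frequently_atTop.1 ht (n + 1)
  exact (hstay k hk).not_gt hkt

section Ascent

/-- A continuous map `T` of `Θ` into itself along which the continuous function `W` does not
decrease, and stays constant only when the image lies in `ℒ`: `W` is a Lyapunov function, with the
sign of an ascent method. Only the restrictions of `T` and `W` to `Θ` matter. -/
structure IsAscentMap {E : Type*} [TopologicalSpace E] (Θ : Set E) (T : E → E) (W : E → ℝ)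
    (ℒ : Set E) : Prop where
  mapsTo : MapsTo T Θ Θ
  continuousOn_map : ContinuousOn T Θ
  continuousOn_value : ContinuousOn W Θ
  le_value : ∀ y ∈ Θ, W y ≤ W (T y)
  mem_of_value_eq : ∀ y ∈ Θ, W (T y) = W y → T y ∈ ℒ

/-- A sequence that stays in a compact subset of `Θ` and follows `T` up to errors tending to `0`. -/
structure IsAsymptoticOrbit {E : Type*} [PseudoMetricSpace E] (Θ : Set E) (T : E → E)
    (θ : ℕ → E) : Prop where
  exists_isCompact : ∃ C ⊆ Θ, IsCompact C ∧ ∀ n, θ n ∈ C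
  tendsto_dist : Tendsto (fun n => dist (T (θ n)) (θ (n + 1))) atTop (𝓝 0)

namespace IsAscentMap

variable {E : Type*} {Θ ℒ : Set E} {T : E → E} {W : E → ℝ}

theorem mono_target [TopologicalSpace E] {ℒ' : Set E} (hT : IsAscentMap Θ T W ℒ) (h : ℒ ⊆ ℒ') :
    IsAscentMap Θ T W ℒ' :=
  { hT with mem_of_value_eq := fun y hy hWy => h (hT.mem_of_value_eq y hy hWy) }

theorem eventually_mapsTo_superlevel [UniformSpace E] {ι : Type*} {l : Filter ι} {F : ι → E → E}
    {c : ℝ} (hT : IsAscentMap Θ T W ℒ) (hF : ∀ i, MapsTo (F i) Θ Θ)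
    (hcompact : IsCompact {t ∈ Θ | c ≤ W t})
    (hlim : TendstoUniformlyOn F T l {t ∈ Θ | c ≤ W t}) (hc : c ∉ W '' ℒ) :
    ∀ᶠ i in l, MapsTo (F i) {t ∈ Θ | c ≤ W t} {t ∈ Θ | c ≤ W t} := by
  have hsub : {t ∈ Θ | c ≤ W t} ⊆ Θ := sep_subset _ _
  have hTcont := hT.continuousOn_map.mono hsub
  have hTmaps := hT.mapsTo.mono_left hsub
  have hgain : ∀ t ∈ {t ∈ Θ | c ≤ W t}, c < W (T t) := fun t ht => by
    have hle := hT.le_value t ht.1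
    refine (ht.2.trans hle).lt_of_ne fun h => hc ⟨T t, ?_, h.symm⟩
    exact hT.mem_of_value_eq t ht.1 (le_antisymm (h ▸ ht.2) hle)
  obtain ⟨c', hcc', hc'⟩ :=
    hcompact.exists_forall_le' (hT.continuousOn_value.comp hTcont hTmaps) hgain
  have hunif := tendstoUniformlyOn_comp_of_isCompact_image hlim
    (hcompact.image_of_continuousOn hTcont) hTmaps (fun i => (hF i).mono_left hsub)
    hT.continuousOn_value
  filter_upwards [Metric.tendstoUniformlyOn_iff.1 hunif _ (sub_pos.2 hcc')] with i hi t ht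
  have hclose := (abs_lt.1 (hi t ht)).2
  have hgap := hc' t ht
  simp only [Function.comp_apply] at hclose hgap
  exact ⟨hF i ht.1, by linarith⟩

variable [PseudoMetricSpace E] {θ : ℕ → E} (hT : IsAscentMap Θ T W ℒ)
  (hθ : IsAsymptoticOrbit Θ T θ)

include hT hθ

theorem isBounded_range_value : Bornology.IsBounded (range fun n => W (θ n)) := by
  obtain ⟨C, hCΘ, hC, hmem⟩ := hθ.exists_isCompact
  refine (hC.image_of_continuousOn (hT.continuousOn_value.mono hCΘ)).isBounded.subset ?_
  exact range_subset_iff.2 fun n => mem_image_of_mem W (hmem n)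

theorem isBoundedUnder_le_value : IsBoundedUnder (· ≤ ·) atTop fun n => W (θ n) :=
  (hT.isBounded_range_value hθ).bddAbove.isBoundedUnder_of_range

theorem isBoundedUnder_ge_value : IsBoundedUnder (· ≥ ·) atTop fun n => W (θ n) :=
  (hT.isBounded_range_value hθ).bddBelow.isBoundedUnder_of_range

theorem exists_tendsto_ultrafilter {U : Ultrafilter ℕ} (hU : ↑U ≤ (atTop : Filter ℕ)) :
    ∃ y ∈ Θ, T y ∈ closure (range θ) ∧ Tendsto (fun n => θ (n + 1)) U (𝓝 (T y)) ∧
      Tendsto (fun n => W (θ n)) U (𝓝 (W y)) ∧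
      Tendsto (fun n => W (θ (n + 1))) U (𝓝 (W (T y))) := by
  obtain ⟨C, hCΘ, hC, hmem⟩ := hθ.exists_isCompact
  have hθΘ : ∀ n, θ n ∈ Θ := fun n => hCΘ (hmem n)
  obtain ⟨y, hyC, hy⟩ := hC.ultrafilter_le_nhds (U.map θ)
    (le_principal_iff.2 (mem_map.2 (univ_mem' hmem)))
  have hyΘ : y ∈ Θ := hCΘ hyC
  have hlim : Tendsto θ U (𝓝[Θ] y) := tendsto_nhdsWithin_iff.2 ⟨hy, Eventually.of_forall hθΘ⟩
  have hsucc : Tendsto (fun n => θ (n + 1)) U (𝓝 (T y)) :=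
    ((hT.continuousOn_map y hyΘ).tendsto.comp hlim).congr_dist (hθ.tendsto_dist.mono_left hU)
  refine ⟨y, hyΘ, mem_closure_of_tendsto hsucc (Eventually.of_forall fun n => mem_range_self _),
    hsucc, (hT.continuousOn_value y hyΘ).tendsto.comp hlim,
    (hT.continuousOn_value _ (hT.mapsTo hyΘ)).tendsto.comp (tendsto_nhdsWithin_iff.2
      ⟨hsucc, Eventually.of_forall fun n => hθΘ _⟩)⟩

theorem liminf_le_limsup_value :
    liminf (fun n => W (θ n)) atTop ≤ limsup (fun n => W (θ n)) atTop :=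
  liminf_le_limsup (hT.isBoundedUnder_le_value hθ) (hT.isBoundedUnder_ge_value hθ)

-- The values rise almost monotonically, so they can only pass below a level `c` along steps that
-- start and end close to `c`; a limit point of such steps is a point of `ℒ` at level `c`.
theorem Icc_liminf_limsup_subset_image :
    Icc (liminf (fun n => W (θ n)) atTop) (limsup (fun n => W (θ n)) atTop) ⊆
      W '' (ℒ ∩ closure (range θ)) := by
  rintro c ⟨hc_ge, hc_le⟩
  have hpos : ∀ k : ℕ, 0 < 1 / ((k : ℝ) + 1) := fun k => Nat.one_div_pos_of_nat
  have hstep : ∀ k : ℕ, ∃ᶠ n in atTop,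
      c - 1 / ((k : ℝ) + 1) ≤ W (θ n) ∧ W (θ (n + 1)) ≤ c + 1 / ((k : ℝ) + 1) := fun k =>
    frequently_le_and_succ_le (by linarith [hpos k])
      (frequently_lt_of_lt_limsup (hT.isBoundedUnder_ge_value hθ).isCoboundedUnder_flip
        (by linarith [hpos k]))
      (frequently_lt_of_liminf_lt (hT.isBoundedUnder_le_value hθ).isCoboundedUnder_flip
        (by linarith [hpos k]))
  obtain ⟨φ, hφ, hφstep⟩ := extraction_forall_of_frequently hstep
  obtain ⟨y, hy, hcl, -, hvalue, hvalue_succ⟩ := hT.exists_tendsto_ultrafilter hθ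
    (U := (hyperfilter ℕ).map φ) ((hφ.tendsto_atTop).mono_left Nat.hyperfilter_le_atTop)
  have herr : Tendsto (fun k : ℕ => 1 / ((k : ℝ) + 1)) (hyperfilter ℕ) (𝓝 0) :=
    tendsto_one_div_add_atTop_nhds_zero_nat.mono_left Nat.hyperfilter_le_atTop
  have hcy : c ≤ W y := by
    simpa using le_of_tendsto_of_tendsto' (herr.const_sub c) (tendsto_map'_iff.1 hvalue)
      fun k => (hφstep k).1
  have hTyc : W (T y) ≤ c := by
    simpa using le_of_tendsto_of_tendsto' (tendsto_map'_iff.1 hvalue_succ) (herr.const_add c)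
      fun k => (hφstep k).2
  have hle := hT.le_value y hy
  exact ⟨T y, ⟨hT.mem_of_value_eq y hy (by linarith), hcl⟩, by linarith⟩

theorem exists_tendsto_infDist_connectedComponentIn :
    ∃ x ∈ W '' (ℒ ∩ closure (range θ)), Tendsto (fun n => Metric.infDist (W (θ n))
      (connectedComponentIn (W '' (ℒ ∩ closure (range θ))) x)) atTop (𝓝 0) := by
  have hsub := hT.Icc_liminf_limsup_subset_image hθ
  have hleft := left_mem_Icc.2 (hT.liminf_le_limsup_value hθ)
  refine ⟨_, hsub hleft, (tendsto_iff_ultrafilter _ _ _).2 fun U hU => ?_⟩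
  obtain ⟨y, -, -, -, hvalue, -⟩ := hT.exists_tendsto_ultrafilter hθ hU
  refine tendsto_infDist_zero_of_tendsto
    (isPreconnected_Icc.subset_connectedComponentIn hleft hsub ⟨?_, ?_⟩) hvalue
  · rw [← hvalue.liminf_eq]
    exact liminf_le_liminf_of_le hU (hT.isBoundedUnder_ge_value hθ)
      hvalue.isBoundedUnder_le.isCoboundedUnder_ge
  · rw [← hvalue.limsup_eq]
    exact limsup_le_limsup_of_le hU hvalue.isBoundedUnder_ge.isCoboundedUnder_le
      (hT.isBoundedUnder_le_value hθ)

theorem exists_tendsto_value_of_interior_eq_empty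
    (hint : interior (W '' (ℒ ∩ closure (range θ))) = ∅) :
    ∃ c, Tendsto (fun n => W (θ n)) atTop (𝓝 c) := by
  have hIoo := interior_mono (hT.Icc_liminf_limsup_subset_image hθ)
  rw [hint, interior_Icc, subset_empty_iff, Ioo_eq_empty_iff, not_lt] at hIoo
  exact ⟨_, tendsto_of_liminf_eq_limsup (le_antisymm (hT.liminf_le_limsup_value hθ) hIoo) rfl
    (hT.isBoundedUnder_le_value hθ) (hT.isBoundedUnder_ge_value hθ)⟩

theorem exists_tendsto_succ_of_tendsto_value {c : ℝ}
    (hc : Tendsto (fun n => W (θ n)) atTop (𝓝 c)) {U : Ultrafilter ℕ}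
    (hU : ↑U ≤ (atTop : Filter ℕ)) :
    ∃ x ∈ {t ∈ ℒ | W t = c} ∩ closure (range θ), Tendsto (fun n => θ (n + 1)) U (𝓝 x) := by
  obtain ⟨y, hy, hcl, hsucc, hvalue, hvalue_succ⟩ := hT.exists_tendsto_ultrafilter hθ hU
  have hWy : W y = c := tendsto_nhds_unique hvalue (hc.mono_left hU)
  have hWTy : W (T y) = c :=
    tendsto_nhds_unique hvalue_succ ((hc.comp (tendsto_add_atTop_nat 1)).mono_left hU)
  exact ⟨T y, ⟨⟨hT.mem_of_value_eq y hy (hWTy.trans hWy.symm), hWTy⟩, hcl⟩, hsucc⟩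

theorem tendsto_infDist_of_tendsto_value {c : ℝ}
    (hc : Tendsto (fun n => W (θ n)) atTop (𝓝 c)) :
    ({t ∈ ℒ | W t = c} ∩ closure (range θ)).Nonempty ∧
      Tendsto (fun n => Metric.infDist (θ n) ({t ∈ ℒ | W t = c} ∩ closure (range θ)))
        atTop (𝓝 0) := by
  constructor
  · obtain ⟨x, hx, -⟩ := hT.exists_tendsto_succ_of_tendsto_value hθ hc Nat.hyperfilter_le_atTop
    exact ⟨x, hx⟩
  · refine (tendsto_add_atTop_iff_nat 1).1 ((tendsto_iff_ultrafilter _ _ _).2 fun U hU => ?_)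
    obtain ⟨x, hx, hlim⟩ := hT.exists_tendsto_succ_of_tendsto_value hθ hc hU
    exact tendsto_infDist_zero_of_tendsto hx hlim

end IsAscentMap

end Ascent

section StableIter

variable {E : Type*} {F : ℕ → E → E} {K : ℕ → Set E} {θ₀ : E}

theorem stableIter_succ_of_mem {n : ℕ}
    (h : F n (stableIter F K θ₀ n).1 ∈ K (stableIter F K θ₀ n).2) :
    stableIter F K θ₀ (n + 1) = (F n (stableIter F K θ₀ n).1, (stableIter F K θ₀ n).2) :=
  if_pos h

theorem stableIter_succ_of_notMem {n : ℕ}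
    (h : F n (stableIter F K θ₀ n).1 ∉ K (stableIter F K θ₀ n).2) :
    stableIter F K θ₀ (n + 1) = (θ₀, (stableIter F K θ₀ n).2 + 1) :=
  if_neg h

theorem monotone_stableIter_snd : Monotone fun n => (stableIter F K θ₀ n).2 := by
  refine monotone_nat_of_le_succ fun n => ?_
  by_cases h : F n (stableIter F K θ₀ n).1 ∈ K (stableIter F K θ₀ n).2
  · rw [stableIter_succ_of_mem h]
  · rw [stableIter_succ_of_notMem h]
    exact Nat.le_succ _

theorem stableIter_fst_mem (hK : Monotone K) (hθ₀ : θ₀ ∈ K 0) :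
    ∀ n, (stableIter F K θ₀ n).1 ∈ K (stableIter F K θ₀ n).2
  | 0 => hθ₀
  | n + 1 => by
    by_cases h : F n (stableIter F K θ₀ n).1 ∈ K (stableIter F K θ₀ n).2
    · rwa [stableIter_succ_of_mem h]
    · rw [stableIter_succ_of_notMem h]
      exact hK (Nat.zero_le _) hθ₀

-- At most one reinitialisation happens after the counter exceeds both `m` and its value at time
-- `N`: it puts the iteration back into `D`, from which the truncation is no longer felt.
theorem bddAbove_range_stableIter_snd_of_mapsTo (hK : Monotone K) {D : Set E} {m N : ℕ}
    (hθ₀ : θ₀ ∈ D) (hD : D ⊆ K m) (hF : ∀ n ≥ N, MapsTo (F n) D D) :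
    BddAbove (range fun n => (stableIter F K θ₀ n).2) := by
  set B := max m (stableIter F K θ₀ N).2
  have hinv : ∀ n ≥ N, (stableIter F K θ₀ n).2 ≤ B ∨
      (stableIter F K θ₀ n).1 ∈ D ∧ (stableIter F K θ₀ n).2 ≤ B + 1 := by
    refine Nat.le_induction (Or.inl (le_max_right _ _)) fun n hn ih => ?_
    by_cases h : F n (stableIter F K θ₀ n).1 ∈ K (stableIter F K θ₀ n).2
    · rw [stableIter_succ_of_mem h]
      exact ih.imp_right fun hmem => ⟨hF n hn hmem.1, hmem.2⟩
    · rw [stableIter_succ_of_notMem h]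
      refine Or.inr ⟨hθ₀, Nat.succ_le_succ (ih.elim id fun hmem => ?_)⟩
      have hlt := not_le.1 fun hle => h (hK hle (hD (hF n hn hmem.1)))
      exact hlt.le.trans (le_max_left _ _)
  refine ⟨B + 1, forall_mem_range.2 fun n => ?_⟩
  refine (monotone_stableIter_snd (le_max_left n N)).trans ?_
  exact (hinv _ (le_max_right n N)).elim (fun h => h.trans (Nat.le_succ B)) And.right

theorem eventually_stableIter_succ_fst
    (hp : BddAbove (range fun n => (stableIter F K θ₀ n).2)) :
    ∀ᶠ n in atTop, (stableIter F K θ₀ (n + 1)).1 = F n (stableIter F K θ₀ n).1 := by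
  obtain ⟨N, hN⟩ := Nat.sSup_mem (range_nonempty fun n => (stableIter F K θ₀ n).2) hp
  filter_upwards [eventually_ge_atTop N] with n hn
  by_cases h : F n (stableIter F K θ₀ n).1 ∈ K (stableIter F K θ₀ n).2
  · rw [stableIter_succ_of_mem h]
  · have hmax := le_csSup hp (mem_range_self (n + 1))
    have hmono := monotone_stableIter_snd (F := F) (K := K) (θ₀ := θ₀) hn
    simp only [← hN, stableIter_succ_of_notMem h] at hmax hmono
    omega

end StableIter

section StableAscent

variable {E : Type*} {Θ ℒ : Set E} {T : E → E} {W : E → ℝ} {F : ℕ → E → E} {K : ℕ → Set E} {θ₀ : E}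

theorem IsTruncationSeq.subset [TopologicalSpace E] (hK : IsTruncationSeq Θ K) (n : ℕ) : K n ⊆ Θ :=
  hK.iUnion_eq ▸ subset_iUnion K n

theorem IsAscentMap.bddAbove_range_stableIter_snd [UniformSpace E] (hT : IsAscentMap Θ T W ℒ)
    (hF : ∀ n, MapsTo (F n) Θ Θ)
    (hlim : ∀ C ⊆ Θ, IsCompact C → TendstoUniformlyOn F T atTop C)
    (hK : IsTruncationSeq Θ K) (hθ₀ : θ₀ ∈ Θ) {c : ℝ} (hc : c ≤ W θ₀) (hcℒ : c ∉ W '' ℒ)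
    (hcompact : IsCompact {t ∈ Θ | c ≤ W t}) :
    BddAbove (range fun n => (stableIter F K θ₀ n).2) := by
  have hsub : {t ∈ Θ | c ≤ W t} ⊆ Θ := sep_subset _ _
  obtain ⟨m, hm⟩ := hK.absorbs _ hsub hcompact
  obtain ⟨N, hN⟩ := eventually_atTop.1
    (hT.eventually_mapsTo_superlevel hF hcompact (hlim _ hsub hcompact) hcℒ)
  exact bddAbove_range_stableIter_snd_of_mapsTo hK.mono (D := {t ∈ Θ | c ≤ W t}) ⟨hθ₀, hc⟩ hm hN

theorem isAsymptoticOrbit_stableIter_fst [PseudoMetricSpace E]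
    (hlim : ∀ C ⊆ Θ, IsCompact C → TendstoUniformlyOn F T atTop C)
    (hK : IsTruncationSeq Θ K) (hθ₀ : θ₀ ∈ K 0)
    (hp : BddAbove (range fun n => (stableIter F K θ₀ n).2)) :
    IsAsymptoticOrbit Θ T fun n => (stableIter F K θ₀ n).1 := by
  have ⟨m, hm⟩ := hp
  have hmem : ∀ n, (stableIter F K θ₀ n).1 ∈ K m := fun n =>
    hK.mono (hm (mem_range_self n)) (stableIter_fst_mem hK.mono hθ₀ n)
  refine ⟨⟨K m, hK.subset m, hK.isCompact m, hmem⟩, Metric.tendsto_nhds.2 fun ε hε => ?_⟩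
  have hunif := Metric.tendstoUniformlyOn_iff.1 (hlim _ (hK.subset m) (hK.isCompact m)) ε hε
  filter_upwards [hunif, eventually_stableIter_succ_fst hp] with n hn hsucc
  rw [hsucc, dist_zero_right, Real.norm_of_nonneg dist_nonneg]
  exact hn _ (hmem n)

end StableAscent

section Tilting

variable {α : Type*} [MeasurableSpace α] {μ : Measure α} {g₁ g₂ : α → ℝ}

theorem integrable_exp_sub_tilted (h₁ : Integrable (fun x => Real.exp (g₁ x)) μ)
    (h₂ : Integrable (fun x => Real.exp (g₂ x)) μ) :
    Integrable (fun x => Real.exp (g₂ x - g₁ x)) (μ.tilted g₁) := by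
  rw [integrable_tilted_iff h₁]
  simpa only [smul_eq_mul, ← Real.exp_add, add_sub_cancel] using h₂

theorem integral_exp_sub_tilted (μ : Measure α) (g₁ g₂ : α → ℝ) :
    ∫ x, Real.exp (g₂ x - g₁ x) ∂μ.tilted g₁ =
      (∫ x, Real.exp (g₂ x) ∂μ) / ∫ x, Real.exp (g₁ x) ∂μ := by
  simpa only [Pi.add_apply, add_sub_cancel] using
    integral_exp_tilted (μ := μ) g₁ (fun x => g₂ x - g₁ x)

theorem integral_exp_mul_exp_integral_sub_le (h₁ : Integrable (fun x => Real.exp (g₁ x)) μ)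
    (h₂ : Integrable (fun x => Real.exp (g₂ x)) μ)
    (hsub : Integrable (fun x => g₂ x - g₁ x) (μ.tilted g₁)) :
    (∫ x, Real.exp (g₁ x) ∂μ) * Real.exp (∫ x, g₂ x - g₁ x ∂μ.tilted g₁) ≤
      ∫ x, Real.exp (g₂ x) ∂μ := by
  rcases eq_zero_or_neZero μ with rfl | _
  · simp
  have := isProbabilityMeasure_tilted h₁
  rw [mul_comm, ← le_div_iff₀ (integral_exp_pos h₁), ← integral_exp_sub_tilted]
  exact convexOn_exp.map_integral_le Real.continuous_exp.continuousOn isClosed_univ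
    (Eventually.of_forall fun _ => mem_univ _) hsub (integrable_exp_sub_tilted h₁ h₂)

theorem tilted_eq_of_integral_exp_eq (h₁ : Integrable (fun x => Real.exp (g₁ x)) μ)
    (h₂ : Integrable (fun x => Real.exp (g₂ x)) μ)
    (hsub : Integrable (fun x => g₂ x - g₁ x) (μ.tilted g₁))
    (heq : ∫ x, Real.exp (g₂ x) ∂μ =
      (∫ x, Real.exp (g₁ x) ∂μ) * Real.exp (∫ x, g₂ x - g₁ x ∂μ.tilted g₁)) :
    μ.tilted g₂ = μ.tilted g₁ := by
  rcases eq_zero_or_neZero μ with rfl | _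
  · simp
  have := isProbabilityMeasure_tilted h₁
  rcases strictConvexOn_exp.ae_eq_const_or_map_average_lt Real.continuous_exp.continuousOn
    isClosed_univ (Eventually.of_forall fun _ => mem_univ _) hsub
    (integrable_exp_sub_tilted h₁ h₂) with hconst | hlt
  · calc μ.tilted g₂ = μ.tilted (g₁ + fun x => g₂ x - g₁ x) := by
          congr 1; ext x; exact (add_sub_cancel _ _).symm
      _ = (μ.tilted g₁).tilted fun x => g₂ x - g₁ x := (tilted_tilted h₁ _).symm
      _ = μ.tilted g₁ := (tilted_congr hconst).trans (tilted_const _ _)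
  · rw [average_eq_integral, average_eq_integral, integral_exp_sub_tilted, heq,
      mul_div_cancel_left₀ _ (integral_exp_pos h₁).ne'] at hlt
    exact (lt_irrefl _ hlt).elim

end Tilting

theorem hasFDerivAt_zero_of_eventually_le {E : Type*} [NormedAddCommGroup E] [NormedSpace ℝ E]
    {f g : E → ℝ} {x : E} (hf : DifferentiableAt ℝ f x) (hg : HasFDerivAt g (0 : E →L[ℝ] ℝ) x)
    (hle : ∀ᶠ y in 𝓝 x, g y ≤ f y) (heq : g x = f x) : HasFDerivAt f (0 : E →L[ℝ] ℝ) x := by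
  have hmin : IsLocalMin (fun y => f y - g y) x := by
    filter_upwards [hle] with y hy
    simpa only [heq, sub_self, sub_nonneg] using hy
  have hzero := hmin.hasFDerivAt_eq_zero (hf.hasFDerivAt.sub hg)
  rw [sub_zero] at hzero
  exact hzero ▸ hf.hasFDerivAt

section CauchySchwarz

theorem enorm_eq_ofReal_rpow_mul {x a b : ℝ} (ha : 0 ≤ a) (h : a * b = x ^ 2) :
    ‖x‖ₑ = ENNReal.ofReal a ^ (1 / 2 : ℝ) * ENNReal.ofReal b ^ (1 / 2 : ℝ) := by
  rw [← ENNReal.mul_rpow_of_nonneg _ _ (by norm_num), ← ENNReal.ofReal_mul ha, h,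
    ENNReal.ofReal_rpow_of_nonneg (sq_nonneg x) (by norm_num), ← Real.sqrt_eq_rpow,
    Real.sqrt_sq_eq_abs, ← Real.norm_eq_abs, ofReal_norm]

theorem lintegral_enorm_le_rpow_mul_rpow {α : Type*} [MeasurableSpace α] {μ : Measure α}
    {g a b : α → ℝ} (ha : AEMeasurable a μ) (hb : AEMeasurable b μ) (ha_nonneg : ∀ z, 0 ≤ a z)
    (hab : ∀ z, a z * b z = g z ^ 2) :
    ∫⁻ z, ‖g z‖ₑ ∂μ ≤ (∫⁻ z, ENNReal.ofReal (a z) ∂μ) ^ (1 / 2 : ℝ) *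
      (∫⁻ z, ENNReal.ofReal (b z) ∂μ) ^ (1 / 2 : ℝ) := by
  simp_rw [fun z => enorm_eq_ofReal_rpow_mul (ha_nonneg z) (hab z)]
  exact ENNReal.lintegral_mul_norm_pow_le ha.ennreal_ofReal hb.ennreal_ofReal (by norm_num)
    (by norm_num) (by norm_num)

theorem tendsto_rpow_mul_rpow_zero {ι : Type*} {l : Filter ι} {A : ℝ≥0∞} (hA : A ≠ ∞)
    {b : ι → ℝ≥0∞} (hb : Tendsto b l (𝓝 0)) {r s : ℝ} (hr : 0 ≤ r) (hs : 0 < s) :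
    Tendsto (fun i => A ^ r * b i ^ s) l (𝓝 0) := by
  have hpow := ((ENNReal.continuous_rpow_const (y := s)).tendsto 0).comp hb
  rw [ENNReal.zero_rpow_of_pos hs] at hpow
  simpa only [mul_zero, Function.comp_apply] using
    ENNReal.Tendsto.const_mul hpow (Or.inr (ENNReal.rpow_ne_top_of_nonneg hr hA))

end CauchySchwarz

namespace CurvedExpFamily

variable {Z : Type*} [MeasurableSpace Z] {l q : ℕ} {μ : Measure Z} {M : CurvedExpFamily Z l q}
  {θhat : EuclideanSpace ℝ (Fin q) → EuclideanSpace ℝ (Fin l)}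
  {ℒ : Set (EuclideanSpace ℝ (Fin l))} {θ θ' : EuclideanSpace ℝ (Fin l)}
  {ptilde : ℕ → EuclideanSpace ℝ (Fin l) → Z → ℝ}

section ExactEM

/-- The conditional distribution `p_θ μ` of the hidden variable, encoded as the exponential tilting
of `μ` by `L(S(·); θ)`. -/
noncomputable def condLaw (M : CurvedExpFamily Z l q) (μ : Measure Z)
    (θ : EuclideanSpace ℝ (Fin l)) : Measure Z :=
  μ.tilted fun z => M.L (M.S z) θ

theorem Sbar_eq_integral_condLaw (M : CurvedExpFamily Z l q) (μ : Measure Z)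
    (θ : EuclideanSpace ℝ (Fin l)) : M.Sbar μ θ = ∫ z, M.S z ∂M.condLaw μ θ :=
  (integral_tilted _ _).symm

theorem L_sub_L (M : CurvedExpFamily Z l q) (s : EuclideanSpace ℝ (Fin q))
    (θ θ' : EuclideanSpace ℝ (Fin l)) :
    M.L s θ' - M.L s θ = (M.ψ θ' - M.ψ θ) + inner ℝ s (M.φ θ' - M.φ θ) := by
  simp only [L, inner_sub_right]
  ring

namespace M2

theorem neZero (hM : M.M2 μ θhat) (hθ : θ ∈ M.Θ) : NeZero μ :=
  ⟨by rintro rfl; simpa [f] using hM.f_pos θ hθ⟩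

theorem isProbabilityMeasure_condLaw (hM : M.M2 μ θhat) (hθ : θ ∈ M.Θ) :
    IsProbabilityMeasure (M.condLaw μ θ) :=
  have := hM.neZero hθ
  isProbabilityMeasure_tilted (hM.f_finite θ hθ)

theorem integrable_S_condLaw (hM : M.M2 μ θhat) (hθ : θ ∈ M.Θ) :
    Integrable M.S (M.condLaw μ θ) := by
  refine (integrable_tilted_iff (hM.f_finite θ hθ) _).2 ?_
  refine ((hM.integrable_S θ hθ).smul (M.f μ θ)).congr (Eventually.of_forall fun z => ?_)
  simp only [Pi.smul_apply, smul_smul, p, mul_div_cancel₀ _ (hM.f_pos θ hθ).ne', h]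

theorem integrable_L_sub_L (hM : M.M2 μ θhat) (hθ : θ ∈ M.Θ) (θ' : EuclideanSpace ℝ (Fin l)) :
    Integrable (fun z => M.L (M.S z) θ' - M.L (M.S z) θ) (M.condLaw μ θ) := by
  have := hM.isProbabilityMeasure_condLaw hθ
  simp only [L_sub_L]
  exact (integrable_const _).add ((hM.integrable_S_condLaw hθ).inner_const _)

theorem integral_L_sub_L (hM : M.M2 μ θhat) (hθ : θ ∈ M.Θ) (θ' : EuclideanSpace ℝ (Fin l)) :
    ∫ z, M.L (M.S z) θ' - M.L (M.S z) θ ∂M.condLaw μ θ =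
      M.L (M.Sbar μ θ) θ' - M.L (M.Sbar μ θ) θ := by
  have := hM.isProbabilityMeasure_condLaw hθ
  have hS := hM.integrable_S_condLaw hθ
  have hinner : ∫ z, inner ℝ (M.S z) (M.φ θ' - M.φ θ) ∂M.condLaw μ θ =
      inner ℝ (M.Sbar μ θ) (M.φ θ' - M.φ θ) := by
    simp only [real_inner_comm (M.φ θ' - M.φ θ), Sbar_eq_integral_condLaw]
    exact integral_inner hS _
  simp only [L_sub_L]
  rw [integral_add (integrable_const _) (hS.inner_const _), hinner, integral_const,
    probReal_univ, one_smul]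

theorem f_mul_exp_le_f (hM : M.M2 μ θhat) (hθ : θ ∈ M.Θ) (hθ' : θ' ∈ M.Θ) :
    M.f μ θ * Real.exp (M.L (M.Sbar μ θ) θ' - M.L (M.Sbar μ θ) θ) ≤ M.f μ θ' := by
  rw [← hM.integral_L_sub_L hθ]
  exact integral_exp_mul_exp_integral_sub_le (hM.f_finite θ hθ) (hM.f_finite θ' hθ')
    (hM.integrable_L_sub_L hθ θ')

theorem Sbar_eq_of_f_eq (hM : M.M2 μ θhat) (hθ : θ ∈ M.Θ) (hθ' : θ' ∈ M.Θ)
    (hL : M.L (M.Sbar μ θ) θ ≤ M.L (M.Sbar μ θ) θ') (hf : M.f μ θ' = M.f μ θ) :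
    M.Sbar μ θ' = M.Sbar μ θ := by
  have hL_eq : M.L (M.Sbar μ θ) θ' - M.L (M.Sbar μ θ) θ = 0 := by
    refine le_antisymm (Real.exp_le_one_iff.1 ?_) (sub_nonneg.2 hL)
    exact (mul_le_iff_le_one_right (hM.f_pos θ hθ)).1 ((hM.f_mul_exp_le_f hθ hθ').trans_eq hf)
  have hlaw : M.condLaw μ θ' = M.condLaw μ θ := by
    refine tilted_eq_of_integral_exp_eq (hM.f_finite θ hθ) (hM.f_finite θ' hθ')
      (hM.integrable_L_sub_L hθ θ') (hf.trans ?_)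
    have hmean := (hM.integral_L_sub_L hθ θ').trans hL_eq
    rw [condLaw] at hmean
    rw [hmean, Real.exp_zero, mul_one]
    rfl
  rw [Sbar_eq_integral_condLaw, Sbar_eq_integral_condLaw, hlaw]

theorem T_mem (hM : M.M2 μ θhat) (hθ : θ ∈ M.Θ) : M.T μ θhat θ ∈ M.Θ :=
  hM.θhat_mem _ (hM.Sbar_mem θ hθ)

theorem L_le_L_T (hM : M.M2 μ θhat) (hθ : θ ∈ M.Θ) (hθ' : θ' ∈ M.Θ) :
    M.L (M.Sbar μ θ) θ' ≤ M.L (M.Sbar μ θ) (M.T μ θhat θ) :=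
  hM.θhat_max _ (hM.Sbar_mem θ hθ) θ' hθ'

theorem isAscentMap_T (hM : M.M2 μ θhat) :
    IsAscentMap M.Θ (M.T μ θhat) (M.f μ) (M.stationarySet μ θhat) where
  mapsTo _ := hM.T_mem
  continuousOn_map := hM.continuousOn_θhat.comp hM.continuousOn_Sbar hM.Sbar_mem
  continuousOn_value := hM.continuousOn_f
  le_value θ hθ :=
    (le_mul_of_one_le_right (hM.f_pos θ hθ).le
      (Real.one_le_exp (sub_nonneg.2 (hM.L_le_L_T hθ hθ)))).trans
        (hM.f_mul_exp_le_f hθ (hM.T_mem hθ))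
  mem_of_value_eq _ hθ hf :=
    ⟨hM.T_mem hθ, congrArg θhat (hM.Sbar_eq_of_f_eq hθ (hM.T_mem hθ) (hM.L_le_L_T hθ hθ) hf)⟩

theorem hasFDerivAt_L_zero (hM : M.M2 μ θhat) (hs : M.Smooth μ)
    (hθ : θ ∈ M.stationarySet μ θhat) :
    HasFDerivAt (M.L (M.Sbar μ θ)) (0 : EuclideanSpace ℝ (Fin l) →L[ℝ] ℝ) θ := by
  have hnhds := hs.isOpen_Θ.mem_nhds hθ.1
  have hmax : IsLocalMax (M.L (M.Sbar μ θ)) θ := by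
    filter_upwards [hnhds] with θ' hθ'
    simpa only [hθ.2] using hM.L_le_L_T hθ.1 hθ'
  have hdiff : DifferentiableAt ℝ (M.L (M.Sbar μ θ)) θ :=
    (hs.differentiableOn_ψ.differentiableAt hnhds).add
      ((differentiableAt_const _).inner ℝ (hs.differentiableOn_φ.differentiableAt hnhds))
  exact hmax.fderiv_eq_zero ▸ hdiff.hasFDerivAt

theorem stationarySet_subset_criticalSet (hM : M.M2 μ θhat) (hs : M.Smooth μ) :
    M.stationarySet μ θhat ⊆ M.criticalSet μ := by
  intro θ hθ
  have hnhds := hs.isOpen_Θ.mem_nhds hθ.1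
  have hminorant : HasFDerivAt
      (fun θ' => M.f μ θ * Real.exp (M.L (M.Sbar μ θ) θ' - M.L (M.Sbar μ θ) θ))
      (0 : EuclideanSpace ℝ (Fin l) →L[ℝ] ℝ) θ := by
    simpa only [smul_zero] using
      ((hM.hasFDerivAt_L_zero hs hθ).sub_const _).exp.const_mul (M.f μ θ)
  refine ⟨hθ.1, hasGradientAt_iff_hasFDerivAt.2 ?_⟩
  rw [map_zero]
  refine hasFDerivAt_zero_of_eventually_le (hs.differentiableOn_f.differentiableAt hnhds) hminorant
    ?_ (by simp only [sub_self, Real.exp_zero, mul_one])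
  filter_upwards [hnhds] with θ' hθ'
  exact hM.f_mul_exp_le_f hθ.1 hθ'

end M2

theorem M3.exists_pos_le_notMem_image (hM3 : M.M3 μ ℒ) (hM : M.M2 μ θhat) (hℒ : ℒ ⊆ M.Θ) {a : ℝ}
    (ha : 0 < a) : ∃ c, 0 < c ∧ c ≤ a ∧ c ∉ M.f μ '' ℒ := by
  rcases hM3 with hcompact | hfinite
  · have hzero : (0 : ℝ) ∈ (M.f μ '' ℒ)ᶜ := by
      rintro ⟨t, ht, hft⟩
      exact (hM.f_pos t (hℒ ht)).ne' hft
    have hnear : ∀ᶠ c in 𝓝[>] (0 : ℝ), c ∉ M.f μ '' ℒ :=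
      mem_nhdsWithin_of_mem_nhds (hcompact.isClosed.isOpen_compl.mem_nhds hzero)
    obtain ⟨c, hc, hca⟩ := (hnear.and (Ioc_mem_nhdsGT ha)).exists
    exact ⟨c, hca.1, hca.2, hc⟩
  · have hlevel := hfinite _ (sep_subset M.Θ fun t => a / 2 ≤ M.f μ t)
      (hM.isCompact_level _ (half_pos ha))
    obtain ⟨c, hc, hcn⟩ := (Ioo_infinite (half_lt_self ha)).exists_notMem_finite hlevel
    refine ⟨c, (half_pos ha).trans hc.1, hc.2.le, ?_⟩
    rintro ⟨t, ht, rfl⟩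
    exact hcn ⟨t, ⟨ht, hℒ ht, hc.1.le⟩, rfl⟩

end ExactEM

section ApproximateEM

theorem measurable_S_apply (M : CurvedExpFamily Z l q) (u : Fin q) :
    Measurable fun z => M.S z u :=
  (EuclideanSpace.proj (𝕜 := ℝ) u).continuous.measurable.comp M.measurable_S

theorem measurable_p (M : CurvedExpFamily Z l q) (μ : Measure Z)
    (θ : EuclideanSpace ℝ (Fin l)) : Measurable (M.p μ θ) :=
  (Real.measurable_exp.comp
    (measurable_const.add (M.measurable_S.inner measurable_const))).div_const _

theorem M2.p_pos (hM : M.M2 μ θhat) (hθ : θ ∈ M.Θ) (z : Z) : 0 < M.p μ θ z :=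
  div_pos (Real.exp_pos _) (hM.f_pos θ hθ)

theorem edist_Stilde_apply_le {r r' : Z → ℝ} (hr : Integrable (fun z => r z • M.S z) μ)
    (hr' : Integrable (fun z => r' z • M.S z) μ) (u : Fin q) :
    edist (M.Stilde μ r u) (M.Stilde μ r' u) ≤ ∫⁻ z, ‖M.S z u * (r z - r' z)‖ₑ ∂μ := by
  have hdiff : M.Stilde μ r u - M.Stilde μ r' u = ∫ z, M.S z u * (r z - r' z) ∂μ := by
    have hproj := (EuclideanSpace.proj (𝕜 := ℝ) u).integral_comp_comm (hr.sub hr')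
    rw [integral_sub' hr hr'] at hproj
    refine hproj.symm.trans (integral_congr_ae (Eventually.of_forall fun z => ?_))
    simp only [Pi.sub_apply, EuclideanSpace.coe_proj, PiLp.sub_apply, PiLp.smul_apply,
      smul_eq_mul]
    ring
  rw [edist_eq_enorm_sub, hdiff]
  exact enorm_integral_le_lintegral_enorm _

theorem ApproxL2.tendstoUniformlyOn_Stilde_apply {C : Set (EuclideanSpace ℝ (Fin l))} {u : Fin q}
    (h : M.ApproxL2 μ ptilde C u) (hM : M.M2 μ θhat) (hE : M.WellDefinedEStep μ ptilde)
    (hC : C ⊆ M.Θ) :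
    TendstoUniformlyOn (fun n θ => M.Stilde μ (ptilde n θ) u) (fun θ => M.Sbar μ θ u) atTop C := by
  refine tendstoUniformlyOn_of_edist_le (tendsto_rpow_mul_rpow_zero h.1.ne h.2 one_half_pos.le
    one_half_pos) fun n θ hθ => ?_
  calc edist (M.Stilde μ (ptilde n θ) u) (M.Sbar μ θ u)
      ≤ ∫⁻ z, ‖M.S z u * (ptilde n θ z - M.p μ θ z)‖ₑ ∂μ :=
        edist_Stilde_apply_le (hE.integrable n θ (hC hθ)) (hM.integrable_S θ (hC hθ)) u
    _ ≤ (∫⁻ z, ENNReal.ofReal (M.S z u ^ 2) ∂μ) ^ (1 / 2 : ℝ) *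
          (∫⁻ z, ENNReal.ofReal ((ptilde n θ z - M.p μ θ z) ^ 2) ∂μ) ^ (1 / 2 : ℝ) :=
        lintegral_enorm_le_rpow_mul_rpow ((M.measurable_S_apply u).pow_const 2).aemeasurable
          (((hE.measurable n θ (hC hθ)).sub (M.measurable_p μ θ)).pow_const 2).aemeasurable
          (fun _ => sq_nonneg _) fun _ => (mul_pow _ _ 2).symm
    _ ≤ _ := by
        gcongr
        exact le_iSup₂_of_le θ hθ le_rfl

theorem ApproxChiSq.tendstoUniformlyOn_Stilde_apply {C : Set (EuclideanSpace ℝ (Fin l))}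
    {u : Fin q} (h : M.ApproxChiSq μ ptilde C u) (hM : M.M2 μ θhat)
    (hE : M.WellDefinedEStep μ ptilde) (hC : C ⊆ M.Θ) :
    TendstoUniformlyOn (fun n θ => M.Stilde μ (ptilde n θ) u) (fun θ => M.Sbar μ θ u) atTop C := by
  refine tendstoUniformlyOn_of_edist_le (tendsto_rpow_mul_rpow_zero h.1.ne h.2 one_half_pos.le
    one_half_pos) fun n θ hθ => ?_
  have hp := hM.p_pos (hC hθ)
  have hpm := M.measurable_p μ θ
  calc edist (M.Stilde μ (ptilde n θ) u) (M.Sbar μ θ u)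
      ≤ ∫⁻ z, ‖M.S z u * (ptilde n θ z - M.p μ θ z)‖ₑ ∂μ :=
        edist_Stilde_apply_le (hE.integrable n θ (hC hθ)) (hM.integrable_S θ (hC hθ)) u
    _ ≤ (∫⁻ z, ENNReal.ofReal (M.S z u ^ 2 * M.p μ θ z) ∂μ) ^ (1 / 2 : ℝ) *
          (∫⁻ z, ENNReal.ofReal ((ptilde n θ z / M.p μ θ z - 1) ^ 2 * M.p μ θ z) ∂μ)
            ^ (1 / 2 : ℝ) := by
        refine lintegral_enorm_le_rpow_mul_rpow
          (((M.measurable_S_apply u).pow_const 2).mul hpm).aemeasurable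
          (((((hE.measurable n θ (hC hθ)).div hpm).sub_const 1).pow_const 2).mul hpm).aemeasurable
          (fun z => mul_nonneg (sq_nonneg _) (hp z).le) fun z => ?_
        have := (hp z).ne'
        field_simp
    _ ≤ _ := by
        gcongr
        · exact le_iSup₂ (f := fun θ (_ : θ ∈ C) =>
            ∫⁻ z, ENNReal.ofReal (M.S z u ^ 2 * M.p μ θ z) ∂μ) θ hθ
        · exact le_iSup₂ (f := fun θ (_ : θ ∈ C) =>
            ∫⁻ z, ENNReal.ofReal ((ptilde n θ z / M.p μ θ z - 1) ^ 2 * M.p μ θ z) ∂μ) θ hθ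

theorem mapsTo_approxMap (hM : M.M2 μ θhat) (hE : M.WellDefinedEStep μ ptilde) (n : ℕ) :
    MapsTo (M.approxMap μ θhat ptilde n) M.Θ M.Θ :=
  fun θ hθ => hM.θhat_mem _ (hE.mem n θ hθ)

theorem tendstoUniformlyOn_approxMap (hM : M.M2 μ θhat) (hE : M.WellDefinedEStep μ ptilde)
    {C : Set (EuclideanSpace ℝ (Fin l))} (hCΘ : C ⊆ M.Θ) (hC : IsCompact C)
    (h : ∀ u, M.ApproxL2 μ ptilde C u ∨ M.ApproxChiSq μ ptilde C u) :
    TendstoUniformlyOn (M.approxMap μ θhat ptilde) (M.T μ θhat) atTop C := by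
  have hStilde : TendstoUniformlyOn (fun n θ => M.Stilde μ (ptilde n θ)) (M.Sbar μ) atTop C :=
    tendstoUniformlyOn_euclideanSpace fun u =>
      (h u).elim (fun hu => hu.tendstoUniformlyOn_Stilde_apply hM hE hCΘ)
        fun hu => hu.tendstoUniformlyOn_Stilde_apply hM hE hCΘ
  exact tendstoUniformlyOn_comp_of_isCompact_image hStilde
    (hC.image_of_continuousOn (hM.continuousOn_Sbar.mono hCΘ))
    (fun θ hθ => hM.Sbar_mem θ (hCΘ hθ)) (fun n θ hθ => hE.mem n θ (hCΘ hθ)) hM.continuousOn_θhat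

end ApproximateEM

end CurvedExpFamily

theorem mainTheorem1_general {Z : Type*} [MeasurableSpace Z] {l q : ℕ}
    (μ : Measure Z) (M : CurvedExpFamily Z l q)
    (θhat : EuclideanSpace ℝ (Fin q) → EuclideanSpace ℝ (Fin l))
    (hM2 : M.M2 μ θhat)
    (ℒ : Set (EuclideanSpace ℝ (Fin l)))
    (hstat : M.stationarySet μ θhat ⊆ ℒ) (hℒ : ℒ ⊆ M.Θ)
    (hM3 : M.M3 μ ℒ)
    (ptilde : ℕ → EuclideanSpace ℝ (Fin l) → Z → ℝ)
    (hE : M.WellDefinedEStep μ ptilde)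
    (happrox : ∀ u : Fin q, ∀ K ⊆ M.Θ, IsCompact K →
      M.ApproxL2 μ ptilde K u ∨ M.ApproxChiSq μ ptilde K u)
    (K : ℕ → Set (EuclideanSpace ℝ (Fin l))) (hK : IsTruncationSeq M.Θ K)
    (θ₀ : EuclideanSpace ℝ (Fin l)) (hθ₀ : θ₀ ∈ K 0)
    (θ : ℕ → EuclideanSpace ℝ (Fin l)) (p : ℕ → ℕ)
    (hθp : ∀ n, (θ n, p n) = stableIter (M.approxMap μ θhat ptilde) K θ₀ n) :
    (BddAbove (range p) ∧ ∃ C ⊆ M.Θ, IsCompact C ∧ ∀ n, θ n ∈ C) ∧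
    (∃ x ∈ M.f μ '' (ℒ ∩ closure (range θ)),
      Tendsto (fun n => Metric.infDist (M.f μ (θ n))
        (connectedComponentIn (M.f μ '' (ℒ ∩ closure (range θ))) x)) atTop (𝓝 0)) ∧
    (interior (M.f μ '' (ℒ ∩ closure (range θ))) = ∅ →
      ∃ fstar : ℝ, Tendsto (fun n => M.f μ (θ n)) atTop (𝓝 fstar) ∧
        ({t ∈ ℒ | M.f μ t = fstar} ∩ closure (range θ)).Nonempty ∧
        Tendsto (fun n => Metric.infDist (θ n)
          ({t ∈ ℒ | M.f μ t = fstar} ∩ closure (range θ))) atTop (𝓝 0)) := by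
  obtain ⟨rfl, rfl⟩ : θ = (fun n => (stableIter (M.approxMap μ θhat ptilde) K θ₀ n).1) ∧
      p = fun n => (stableIter (M.approxMap μ θhat ptilde) K θ₀ n).2 :=
    ⟨funext fun n => congrArg Prod.fst (hθp n), funext fun n => congrArg Prod.snd (hθp n)⟩
  have hT : IsAscentMap M.Θ (M.T μ θhat) (M.f μ) ℒ :=
    hM2.isAscentMap_T.mono_target hstat
  have hlim : ∀ C ⊆ M.Θ, IsCompact C →
      TendstoUniformlyOn (M.approxMap μ θhat ptilde) (M.T μ θhat) atTop C := fun C hCΘ hC =>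
    CurvedExpFamily.tendstoUniformlyOn_approxMap hM2 hE hCΘ hC fun u => happrox u C hCΘ hC
  have hθ₀Θ : θ₀ ∈ M.Θ := hK.subset 0 hθ₀
  obtain ⟨c, hc, hcθ₀, hcℒ⟩ := hM3.exists_pos_le_notMem_image hM2 hℒ (hM2.f_pos θ₀ hθ₀Θ)
  have hp := hT.bddAbove_range_stableIter_snd (CurvedExpFamily.mapsTo_approxMap hM2 hE) hlim hK
    hθ₀Θ hcθ₀ hcℒ (hM2.isCompact_level c hc)
  have hθ := isAsymptoticOrbit_stableIter_fst hlim hK hθ₀ hp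
  refine ⟨⟨hp, hθ.exists_isCompact⟩, hT.exists_tendsto_infDist_connectedComponentIn hθ,
    fun hint => ?_⟩
  obtain ⟨fstar, hfstar⟩ := hT.exists_tendsto_value_of_interior_eq_empty hθ hint
  exact ⟨fstar, hfstar, hT.tendsto_infDist_of_tendsto_value hθ hfstar⟩

theorem mainTheorem1 {Z : Type*} [MeasurableSpace Z] {l q : ℕ}
    (μ : Measure Z) [SigmaFinite μ] (M : CurvedExpFamily Z l q)
    (θhat : EuclideanSpace ℝ (Fin q) → EuclideanSpace ℝ (Fin l))
    (hM2 : M.M2 μ θhat)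
    (ℒ : Set (EuclideanSpace ℝ (Fin l)))
    (hℒ : ℒ = M.stationarySet μ θhat ∨ (M.Smooth μ ∧ ℒ = M.criticalSet μ))
    (hM3 : M.M3 μ ℒ)
    (ptilde : ℕ → EuclideanSpace ℝ (Fin l) → Z → ℝ)
    (hE : M.WellDefinedEStep μ ptilde)
    (happrox : ∀ u : Fin q, ∀ K ⊆ M.Θ, IsCompact K →
      M.ApproxL2 μ ptilde K u ∨ M.ApproxChiSq μ ptilde K u)
    (K : ℕ → Set (EuclideanSpace ℝ (Fin l))) (hK : IsTruncationSeq M.Θ K)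
    (θ₀ : EuclideanSpace ℝ (Fin l)) (hθ₀ : θ₀ ∈ K 0)
    (θ : ℕ → EuclideanSpace ℝ (Fin l)) (p : ℕ → ℕ)
    (hθp : ∀ n, (θ n, p n) = stableIter (M.approxMap μ θhat ptilde) K θ₀ n) :
    -- finitely many reinitialisations, and the sequence stays in a compact set
    (BddAbove (range p) ∧ ∃ C ⊆ M.Θ, IsCompact C ∧ ∀ n, θ n ∈ C) ∧
    -- the likelihood values converge to a connected component
    (∃ x ∈ M.f μ '' (ℒ ∩ closure (range θ)),
      Tendsto (fun n => Metric.infDist (M.f μ (θ n))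
        (connectedComponentIn (M.f μ '' (ℒ ∩ closure (range θ))) x)) atTop (𝓝 0)) ∧
    -- convergence of the values and of the sequence when the image has empty interior
    (interior (M.f μ '' (ℒ ∩ closure (range θ))) = ∅ →
      ∃ fstar : ℝ, Tendsto (fun n => M.f μ (θ n)) atTop (𝓝 fstar) ∧
        ({t ∈ ℒ | M.f μ t = fstar} ∩ closure (range θ)).Nonempty ∧
        Tendsto (fun n => Metric.infDist (θ n)
          ({t ∈ ℒ | M.f μ t = fstar} ∩ closure (range θ))) atTop (𝓝 0)) := by
  have hsub : M.stationarySet μ θhat ⊆ ℒ ∧ ℒ ⊆ M.Θ := by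
    rcases hℒ with rfl | ⟨hs, rfl⟩
    exacts [⟨Subset.rfl, sep_subset _ _⟩,
      ⟨hM2.stationarySet_subset_criticalSet hs, sep_subset _ _⟩]
  exact mainTheorem1_general μ M θhat hM2 ℒ hsub.1 hsub.2 hM3 ptilde hE happrox K hK θ₀ hθ₀ θ p hθp
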